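/- Let $\mathcal H$ be a complex Hilbert space, let $A,B$ be compact self-adjoint operators on $\mathcal H$, and let $\rho$ be a density operator, i.e. a positive trace-class operator with $\mathrm{tr}[\rho]=1$. For $a\in\sigma(A)$ let $P_A(a)$ be the orthogonal projection onto $\ker(A-a)$, and define $P_B(b)$ for $b\in\sigma(B)$ in the same way. Put $\Lambda_A(\rho)=\sum_{a\in\sigma(A)}P_A(a)\,\rho\,P_A(a)$ and $\mathrm{Inv}_A(\rho)=\|\Lambda_A(\rho)-\rho\|_1$, where $\|\cdot\|_1$ is the trace norm and $\|\cdot\|$ is the operator norm. For $\alpha\in[0,1]$ put $X\circ_\alpha Y=\alpha XY+(1-\alpha)YX$, and define $$P^{A\to B}_\rho(a\to b)=\mathrm{tr}\bigl[P_A(a)\,\rho\,P_A(a)\,P_B(b)\bigr],\qquad P^{\alpha}_\rho(a,b)=\mathrm{tr}\bigl[\rho\,\bigl(P_A(a)\circ_\alpha P_B(b)\bigr)\bigr].$$ Then the series $\Lambda_A(\rho)$ converges unconditionally in operator norm, the operator $\Lambda_A(\rho)-\rho$ is trace class, and for all $\alpha\in[0,1]$, $a\in\sigma(A)$ and $b\in\sigma(B)$,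 $$\bigl|P^{A\to B}_\rho(a\to b)-P^{\alpha}_\rho(a,b)\bigr|\le\min\bigl\{\|[P_A(a),P_B(b)]\|,\ \|P_A(a)\circ_\alpha P_B(b)\|\bigr\}\,\mathrm{Inv}_A(\rho).$$ -/

import Mathlib

open scoped InnerProductSpace

namespace QuantumInvasiveness

noncomputable section

variable {H : Type*} [NormedAddCommGroup H] [InnerProductSpace ℂ H] [CompleteSpace H]

/-- Index set of a fixed orthonormal (Hilbert) basis of `H`. -/
def basisIndex (H : Type*) [NormedAddCommGroup H] [InnerProductSpace ℂ H] [CompleteSpace H] :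
    Set H :=
  Classical.choose (exists_hilbertBasis ℂ H)

/-- A fixed orthonormal (Hilbert) basis of `H`. -/
def basis (H : Type*) [NormedAddCommGroup H] [InnerProductSpace ℂ H] [CompleteSpace H] :
    HilbertBasis (basisIndex H) ℂ H :=
  Classical.choose (Classical.choose_spec (exists_hilbertBasis ℂ H))

/-- `T` is trace class: `∑ i, ⟪e i, |T| e i⟫ < ∞`, where `|T| = √(T† T)`.
Since `|T| ≥ 0`, this does not depend on the orthonormal basis. -/
def IsTraceClass (T : H →L[ℂ] H) : Prop :=
  Summable fun i => ⟪basis H i, CFC.abs T (basis H i)⟫_ℂ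

/-- The trace `tr T = ∑ i, ⟪e i, T e i⟫`; for a trace class operator the series converges
absolutely and its sum does not depend on the orthonormal basis. -/
def trace (T : H →L[ℂ] H) : ℂ :=
  ∑' i, ⟪basis H i, T (basis H i)⟫_ℂ

/-- The trace norm `‖T‖₁ = tr |T|` of a trace class operator. -/
def traceNorm (T : H →L[ℂ] H) : ℝ :=
  (trace (CFC.abs T)).re

/-- Density operators: positive trace class operators of trace one. -/
structure IsState (ρ : H →L[ℂ] H) : Prop where
  isPositive : ρ.IsPositive
  isTraceClass : IsTraceClass ρ
  trace_eq_one : trace ρ = 1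

/-- Observables with spectral family indexed by the points of the spectrum:
compact self-adjoint operators. -/
structure IsObservable (A : H →L[ℂ] H) : Prop where
  isSelfAdjoint : IsSelfAdjoint A
  isCompact : IsCompactOperator A

/-- The spectral projection `P_A(a)`: the orthogonal projection onto the eigenspace
`ker (A - a)`. -/
def specProj (A : H →L[ℂ] H) (a : ℝ) : H →L[ℂ] H :=
  (A - (a : ℂ) • (1 : H →L[ℂ] H)).ker.starProjection

/-- The Lüders operation `Π_A(a) : ρ ↦ P_A(a) ρ P_A(a)`. -/
def lueders (A : H →L[ℂ] H) (a : ℝ) (ρ : H →L[ℂ] H) : H →L[ℂ] H :=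
  specProj A a * ρ * specProj A a

/-- The non-selective process `Λ_A(ρ) = ∑_{a ∈ σ(A)} Π_A(a)(ρ)`. -/
def nonselective (A ρ : H →L[ℂ] H) : H →L[ℂ] H :=
  ∑' a : spectrum ℝ A, lueders A a ρ

/-- The invasiveness `Inv_A(ρ) = ‖Λ_A(ρ) - ρ‖₁`. -/
def invasiveness (A ρ : H →L[ℂ] H) : ℝ :=
  traceNorm (nonselective A ρ - ρ)

/-- `X ∘_α Y = α X Y + (1 - α) Y X`. -/
def alphaProd (α : ℝ) (X Y : H →L[ℂ] H) : H →L[ℂ] H :=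
  (α : ℂ) • (X * Y) + (1 - (α : ℂ)) • (Y * X)

/-- The operational joint probability `P^{A→B}_ρ(a→b) = tr[Π_A(a)(ρ) P_B(b)]`. -/
def opProb (A B ρ : H →L[ℂ] H) (a b : ℝ) : ℂ :=
  trace (lueders A a ρ * specProj B b)

/-- The quasi-joint distribution `P^α_ρ(a,b) = tr[ρ (P_A(a) ∘_α P_B(b))]`. -/
def quasiProb (α : ℝ) (A B ρ : H →L[ℂ] H) (a b : ℝ) : ℂ :=
  trace (ρ * alphaProd α (specProj A a) (specProj B b))

end

end QuantumInvasiveness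

/-! Write P = P_A(a), Q = P_B(b), Δ = Λ_A(ρ) - ρ. Orthogonality of the eigenspaces gives PΛ_A(ρ) =
Λ_A(ρ)P = PρP, so by cyclicity tr[Λ_A(ρ)PQ] and tr[Λ_A(ρ)QP] both equal the operational probability.
Hence the difference to be bounded is tr[Δ(P ∘_α Q)] for every α (`opProb_sub_quasiProb`), and
Hölder (`norm_trace_mul_le`) yields the second bound. For the commutator bound, PΔP = 0 gives tr[Δ
PQP] = 0. So under tr[Δ ·] one may replace PQ by P[P,Q] and QP by -[P,Q]P, both of norm at most
‖[P,Q]‖; then take the convex combination. The analysis rests on ρ = R² with R self-adjoint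
Hilbert–Schmidt: trace identities reduce to Fubini for matrix entries, and convergence of Λ_A(ρ) to
Bessel's inequality. -/

open scoped InnerProductSpace

namespace QuantumInvasiveness

/-! ### Hilbert–Schmidt operators through matrix entries in the fixed basis. -/

section HilbertSchmidt

variable {H : Type*} [NormedAddCommGroup H] [InnerProductSpace ℂ H] [CompleteSpace H]

/-- Hilbert–Schmidt operators: `∑ i, ‖T e i‖² < ∞`. -/
def IsHilbertSchmidt (T : H →L[ℂ] H) : Prop :=
  Summable fun i => ‖T (basis H i)‖ ^ 2

/-- The squared Hilbert–Schmidt norm `∑ i, ‖T e i‖²`. -/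
noncomputable def hsNormSq (T : H →L[ℂ] H) : ℝ :=
  ∑' i, ‖T (basis H i)‖ ^ 2

/-- The series defining the trace of `T` converges. -/
def DiagSummable (T : H →L[ℂ] H) : Prop :=
  Summable fun i => ⟪basis H i, T (basis H i)⟫_ℂ

theorem hasSum_norm_inner_sq (x : H) :
    HasSum (fun i => ‖⟪basis H i, x⟫_ℂ‖ ^ 2) (‖x‖ ^ 2) := by
  have h := (basis H).hasSum_inner_mul_inner x x
  have hx : ⟪x, x⟫_ℂ = ((‖x‖ ^ 2 : ℝ) : ℂ) := by
    rw [inner_self_eq_norm_sq_to_K]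
    push_cast
    rfl
  have hi : ∀ i, ⟪x, basis H i⟫_ℂ * ⟪basis H i, x⟫_ℂ =
      ((‖⟪basis H i, x⟫_ℂ‖ ^ 2 : ℝ) : ℂ) := fun i => by
    rw [← inner_conj_symm x (basis H i)]
    push_cast
    exact Complex.conj_mul' _
  rw [hx, funext hi] at h
  exact Complex.hasSum_ofReal.mp h

theorem summable_norm_inner_sq {T : H →L[ℂ] H} (hT : IsHilbertSchmidt T) :
    Summable fun p : basisIndex H × basisIndex H =>
      ‖⟪basis H p.2, T (basis H p.1)⟫_ℂ‖ ^ 2 := by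
  refine (summable_prod_of_nonneg fun _ => by positivity).mpr
    ⟨fun i => (hasSum_norm_inner_sq (T (basis H i))).summable, ?_⟩
  refine Summable.congr hT fun i => ?_
  exact (hasSum_norm_inner_sq (T (basis H i))).tsum_eq.symm

theorem norm_inner_star_swap (T : H →L[ℂ] H) (x y : H) :
    ‖⟪y, (star T) x⟫_ℂ‖ = ‖⟪x, T y⟫_ℂ‖ := by
  rw [ContinuousLinearMap.star_eq_adjoint, ContinuousLinearMap.adjoint_inner_right,
    norm_inner_symm]

/-- The adjoint has the conjugate transposed matrix, so its column sums are the row sums of a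
summable double series. -/
theorem isHilbertSchmidt_star {T : H →L[ℂ] H} (hT : IsHilbertSchmidt T) :
    IsHilbertSchmidt (star T) := by
  have h := (summable_norm_inner_sq hT).prod_symm.prod
  refine h.congr fun i => ?_
  rw [← (hasSum_norm_inner_sq ((star T) (basis H i))).tsum_eq]
  simp only [Prod.swap_prod_mk, norm_inner_star_swap]

theorem hsNormSq_star {T : H →L[ℂ] H} (hT : IsHilbertSchmidt T) :
    hsNormSq (star T) = hsNormSq T := by
  have h := (summable_norm_inner_sq hT).prod_symm.tsum_comm
    (f := fun i j => ‖⟪basis H i, T (basis H j)⟫_ℂ‖ ^ 2)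
  unfold hsNormSq
  calc ∑' i, ‖(star T) (basis H i)‖ ^ 2
      = ∑' i, ∑' j, ‖⟪basis H i, T (basis H j)⟫_ℂ‖ ^ 2 := by
        refine tsum_congr fun i => ?_
        rw [← (hasSum_norm_inner_sq ((star T) (basis H i))).tsum_eq]
        simp only [norm_inner_star_swap]
    _ = ∑' j, ∑' i, ‖⟪basis H i, T (basis H j)⟫_ℂ‖ ^ 2 := h.symm
    _ = ∑' j, ‖T (basis H j)‖ ^ 2 :=
        tsum_congr fun j => (hasSum_norm_inner_sq (T (basis H j))).tsum_eq

omit [CompleteSpace H] in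
theorem norm_mul_apply_sq_le (X T : H →L[ℂ] H) (x : H) :
    ‖(X * T) x‖ ^ 2 ≤ ‖X‖ ^ 2 * ‖T x‖ ^ 2 := by
  rw [← mul_pow]
  exact pow_le_pow_left₀ (norm_nonneg _) (X.le_opNorm _) 2

theorem IsHilbertSchmidt.mul_left {T : H →L[ℂ] H} (hT : IsHilbertSchmidt T) (X : H →L[ℂ] H) :
    IsHilbertSchmidt (X * T) :=
  Summable.of_nonneg_of_le (fun _ => by positivity) (fun _ => norm_mul_apply_sq_le X T _)
    (Summable.mul_left (‖X‖ ^ 2) hT)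

theorem IsHilbertSchmidt.mul_right {T : H →L[ℂ] H} (hT : IsHilbertSchmidt T) (X : H →L[ℂ] H) :
    IsHilbertSchmidt (T * X) := by
  simpa using isHilbertSchmidt_star ((isHilbertSchmidt_star hT).mul_left (star X))

/-- Cauchy–Schwarz on each coefficient ⟪e i, T† x⟫ = ⟪T e i, x⟫ and Parseval bound the adjoint,
which has the same norm. -/
theorem norm_sq_le_hsNormSq {T : H →L[ℂ] H} (hT : IsHilbertSchmidt T) :
    ‖T‖ ^ 2 ≤ hsNormSq T := by
  have h0 : 0 ≤ hsNormSq T := tsum_nonneg fun _ => by positivity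
  have key : ‖star T‖ ≤ √(hsNormSq T) := by
    refine ContinuousLinearMap.opNorm_le_bound _ (Real.sqrt_nonneg _) fun x => ?_
    refine le_of_sq_le_sq ?_ (by positivity)
    rw [mul_pow, Real.sq_sqrt h0, ← (hasSum_norm_inner_sq ((star T) x)).tsum_eq]
    unfold hsNormSq
    rw [← tsum_mul_right]
    refine Summable.tsum_le_tsum (fun i => ?_) (hasSum_norm_inner_sq _).summable
      (Summable.mul_right _ hT)
    rw [norm_inner_star_swap, ← mul_pow, mul_comm]
    exact pow_le_pow_left₀ (norm_nonneg _) (norm_inner_le_norm _ _) 2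
  rw [norm_star] at key
  calc ‖T‖ ^ 2 ≤ √(hsNormSq T) ^ 2 := pow_le_pow_left₀ (norm_nonneg _) key 2
    _ = hsNormSq T := Real.sq_sqrt h0

theorem hasSum_inner_mul_apply (X Y : H →L[ℂ] H) (x y : H) :
    HasSum (fun j => ⟪x, X (basis H j)⟫_ℂ * ⟪basis H j, Y y⟫_ℂ) ⟪x, (X * Y) y⟫_ℂ := by
  have h := (basis H).hasSum_inner_mul_inner ((star X) x) (Y y)
  simp only [ContinuousLinearMap.star_eq_adjoint, ContinuousLinearMap.adjoint_inner_left] at h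
  exact h

theorem summable_matrix_mul {X Y : H →L[ℂ] H} (hX : IsHilbertSchmidt X)
    (hY : IsHilbertSchmidt Y) :
    Summable fun p : basisIndex H × basisIndex H =>
      ⟪basis H p.1, X (basis H p.2)⟫_ℂ * ⟪basis H p.2, Y (basis H p.1)⟫_ℂ := by
  refine Summable.of_norm_bounded
    ((summable_norm_inner_sq hX).prod_symm.add (summable_norm_inner_sq hY)) fun p => ?_
  rw [norm_mul]
  simp only [Prod.fst_swap, Prod.snd_swap]
  -- uv ≤ u² + v².
  nlinarith [sq_nonneg (‖⟪basis H p.1, X (basis H p.2)⟫_ℂ‖ - ‖⟪basis H p.2, Y (basis H p.1)⟫_ℂ‖),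
    sq_nonneg (‖⟪basis H p.1, X (basis H p.2)⟫_ℂ‖ + ‖⟪basis H p.2, Y (basis H p.1)⟫_ℂ‖)]

theorem IsHilbertSchmidt.diagSummable_mul {X Y : H →L[ℂ] H} (hX : IsHilbertSchmidt X)
    (hY : IsHilbertSchmidt Y) : DiagSummable (X * Y) :=
  (summable_matrix_mul hX hY).prod.congr fun i =>
    (hasSum_inner_mul_apply X Y (basis H i) (basis H i)).tsum_eq

theorem IsHilbertSchmidt.trace_mul_comm {X Y : H →L[ℂ] H} (hX : IsHilbertSchmidt X)
    (hY : IsHilbertSchmidt Y) : trace (X * Y) = trace (Y * X) := by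
  have h := (summable_matrix_mul hX hY).tsum_comm
    (f := fun i j => ⟪basis H i, X (basis H j)⟫_ℂ * ⟪basis H j, Y (basis H i)⟫_ℂ)
  unfold trace
  calc ∑' i, ⟪basis H i, (X * Y) (basis H i)⟫_ℂ
      = ∑' i, ∑' j, ⟪basis H i, X (basis H j)⟫_ℂ * ⟪basis H j, Y (basis H i)⟫_ℂ :=
        tsum_congr fun i => (hasSum_inner_mul_apply X Y _ _).tsum_eq.symm
    _ = ∑' j, ∑' i, ⟪basis H i, X (basis H j)⟫_ℂ * ⟪basis H j, Y (basis H i)⟫_ℂ := h.symm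
    _ = ∑' j, ⟪basis H j, (Y * X) (basis H j)⟫_ℂ := by
        refine tsum_congr fun j => ?_
        rw [← (hasSum_inner_mul_apply Y X (basis H j) (basis H j)).tsum_eq]
        exact tsum_congr fun i => mul_comm _ _

end HilbertSchmidt

/-! ### Trace, modulus and Hölder's inequality. -/

section Trace

variable {H : Type*} [NormedAddCommGroup H] [InnerProductSpace ℂ H] [CompleteSpace H]

theorem trace_add {S T : H →L[ℂ] H} (hS : DiagSummable S) (hT : DiagSummable T) :
    trace (S + T) = trace S + trace T := by
  unfold trace
  rw [← Summable.tsum_add hS hT]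
  exact tsum_congr fun i => by simp

theorem trace_sub {S T : H →L[ℂ] H} (hS : DiagSummable S) (hT : DiagSummable T) :
    trace (S - T) = trace S - trace T := by
  unfold trace
  rw [← Summable.tsum_sub hS hT]
  exact tsum_congr fun i => by simp

theorem trace_smul (c : ℂ) (T : H →L[ℂ] H) : trace (c • T) = c * trace T := by
  unfold trace
  rw [← tsum_mul_left]
  exact tsum_congr fun i => by simp

theorem DiagSummable.sub {S T : H →L[ℂ] H} (hS : DiagSummable S) (hT : DiagSummable T) :
    DiagSummable (S - T) :=
  (Summable.sub hS hT).congr fun i => by simp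

theorem DiagSummable.smul {T : H →L[ℂ] H} (hT : DiagSummable T) (c : ℂ) :
    DiagSummable (c • T) :=
  (Summable.mul_left c hT).congr fun i => by simp

theorem inner_mul_self_apply {R : H →L[ℂ] H} (hR : IsSelfAdjoint R) (T : H →L[ℂ] H) (x : H) :
    ⟪x, (R * T) x⟫_ℂ = ⟪R x, T x⟫_ℂ := by
  have h := ContinuousLinearMap.adjoint_inner_left R (T x) x
  rw [← ContinuousLinearMap.star_eq_adjoint, hR.star_eq] at h
  exact h.symm

theorem inner_mul_self_eq_norm_sq {R : H →L[ℂ] H} (hR : IsSelfAdjoint R) (x : H) :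
    ⟪x, (R * R) x⟫_ℂ = ((‖R x‖ ^ 2 : ℝ) : ℂ) := by
  rw [inner_mul_self_apply hR, inner_self_eq_norm_sq_to_K]
  push_cast
  rfl

theorem trace_mul_self {R : H →L[ℂ] H} (hR : IsSelfAdjoint R) :
    trace (R * R) = (hsNormSq R : ℂ) := by
  unfold trace hsNormSq
  rw [Complex.ofReal_tsum]
  exact tsum_congr fun i => inner_mul_self_eq_norm_sq hR _

/-- A positive operator with summable diagonal is the square of a self-adjoint
Hilbert–Schmidt operator. -/
theorem exists_isHilbertSchmidt_mul_self {S : H →L[ℂ] H} (hS : 0 ≤ S) (h : DiagSummable S) :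
    ∃ R : H →L[ℂ] H, IsSelfAdjoint R ∧ IsHilbertSchmidt R ∧ R * R = S := by
  have hR : IsSelfAdjoint (CFC.sqrt S) := (CFC.sqrt_nonneg S).isSelfAdjoint
  have hRS : CFC.sqrt S * CFC.sqrt S = S := CFC.sqrt_mul_sqrt_self S hS
  refine ⟨CFC.sqrt S, hR, ?_, hRS⟩
  refine Complex.summable_ofReal.mp (h.congr fun i => ?_)
  rw [← inner_mul_self_eq_norm_sq hR, hRS]

theorem diagSummable_mul {S : H →L[ℂ] H} (hS : 0 ≤ S) (h : DiagSummable S) (T : H →L[ℂ] H) :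
    DiagSummable (S * T) := by
  obtain ⟨R, -, hR, rfl⟩ := exists_isHilbertSchmidt_mul_self hS h
  rw [mul_assoc]
  exact hR.diagSummable_mul (hR.mul_right T)

/-- With S = R², each swap is made with one copy of R in either factor, so that both factors are
Hilbert–Schmidt although T and X are only bounded. -/
theorem trace_mul_mul_cycle {S : H →L[ℂ] H} (hS : 0 ≤ S) (h : DiagSummable S)
    (T X : H →L[ℂ] H) : trace (S * (T * X)) = trace (X * S * T) := by
  obtain ⟨R, -, hR, rfl⟩ := exists_isHilbertSchmidt_mul_self hS h
  calc trace (R * R * (T * X)) = trace (R * (R * (T * X))) := by rw [mul_assoc]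
    _ = trace (R * (T * X) * R) := hR.trace_mul_comm (hR.mul_right (T * X))
    _ = trace (R * T * (X * R)) := by simp only [mul_assoc]
    _ = trace (X * R * (R * T)) := (hR.mul_right T).trace_mul_comm (hR.mul_left X)
    _ = trace (X * (R * R) * T) := by simp only [mul_assoc]

theorem trace_mul_comm {S : H →L[ℂ] H} (hS : 0 ≤ S) (h : DiagSummable S) (T : H →L[ℂ] H) :
    trace (S * T) = trace (T * S) := by
  simpa using trace_mul_mul_cycle hS h 1 T

theorem norm_trace_mul_le_of_nonneg {S : H →L[ℂ] H} (hS : 0 ≤ S) (h : DiagSummable S)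
    (T : H →L[ℂ] H) : ‖trace (S * T)‖ ≤ ‖T‖ * (trace S).re := by
  obtain ⟨R, hsa, hR, rfl⟩ := exists_isHilbertSchmidt_mul_self hS h
  have hb : ∀ i, ‖⟪basis H i, (R * (T * R)) (basis H i)⟫_ℂ‖ ≤ ‖T‖ * ‖R (basis H i)‖ ^ 2 := by
    intro i
    rw [inner_mul_self_apply hsa]
    refine (norm_inner_le_norm _ _).trans ?_
    have := T.le_opNorm (R (basis H i))
    calc ‖R (basis H i)‖ * ‖T (R (basis H i))‖
        ≤ ‖R (basis H i)‖ * (‖T‖ * ‖R (basis H i)‖) := by gcongr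
      _ = ‖T‖ * ‖R (basis H i)‖ ^ 2 := by ring
  rw [mul_assoc, hR.trace_mul_comm (hR.mul_right T), mul_assoc, trace_mul_self hsa,
    Complex.ofReal_re]
  unfold trace hsNormSq
  rw [← tsum_mul_left]
  exact tsum_of_norm_bounded (Summable.mul_left ‖T‖ hR).hasSum hb

/-- The modulus of a self-adjoint operator `D` is `D * (2 E - 1)`, where `E` is the projection
onto the closure of the range of the positive part of `D`. -/
theorem exists_abs_eq_mul {D : H →L[ℂ] H} (hD : IsSelfAdjoint D) :
    ∃ U : H →L[ℂ] H, CFC.abs D = D * U := by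
  -- The projection E onto this kernel satisfies D⁻E = 0 and, since D⁻D⁺ = 0, also D⁺E = D⁺; only
  -- these two identities matter.
  let K : Submodule ℂ H := (D⁻ : H →L[ℂ] H).ker
  have hK : IsClosed (K : Set H) := (D⁻ : H →L[ℂ] H).isClosed_ker
  have : CompleteSpace K := hK.completeSpace_coe
  have hneg : D⁻ * K.starProjection = 0 := by
    ext x
    exact (K.starProjection_apply_mem x : _)
  have hpos : D⁺ * K.starProjection = D⁺ := by
    have h1 : K.starProjection * D⁺ = D⁺ := by
      ext x
      refine Submodule.starProjection_eq_self_iff.mpr ?_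
      change D⁻ (D⁺ x) = 0
      exact congrArg (fun T : H →L[ℂ] H => T x) (CFC.negPart_mul_posPart D)
    have h2 := congrArg star h1
    rwa [star_mul, (CFC.posPart_nonneg D).isSelfAdjoint.star_eq,
      isStarProjection_starProjection.isSelfAdjoint.star_eq] at h2
  refine ⟨(2 : ℂ) • K.starProjection - 1, ?_⟩
  have hD' : D = D⁺ - D⁻ := (CFC.posPart_sub_negPart D hD).symm
  calc CFC.abs D = D⁺ + D⁻ := (CFC.posPart_add_negPart D hD).symm
    _ = (2 : ℂ) • (D⁺ * K.starProjection - D⁻ * K.starProjection) - (D⁺ - D⁻) := by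
        rw [hpos, hneg, sub_zero, two_smul]; abel
    _ = (D⁺ - D⁻) * ((2 : ℂ) • K.starProjection - 1) := by
        rw [mul_sub, mul_smul_comm, sub_mul, mul_one]
    _ = D * ((2 : ℂ) • K.starProjection - 1) := by rw [← hD']

/-- The difference of two positive trace class operators is trace class. -/
theorem isTraceClass_sub {S T : H →L[ℂ] H} (hS : 0 ≤ S) (hS' : DiagSummable S) (hT : 0 ≤ T)
    (hT' : DiagSummable T) : IsTraceClass (S - T) := by
  -- |S - T| = SU - TU, and both terms have summable diagonal.
  obtain ⟨U, hU⟩ := exists_abs_eq_mul (hS.isSelfAdjoint.sub hT.isSelfAdjoint)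
  have h := (diagSummable_mul hS hS' U).sub (diagSummable_mul hT hT' U)
  rw [← sub_mul, ← hU] at h
  exact h

open scoped ComplexOrder in
theorem DiagSummable.of_le {S T : H →L[ℂ] H} (hS : 0 ≤ S) (hST : S ≤ T) (hT : DiagSummable T) :
    DiagSummable S := by
  refine Summable.of_norm_bounded hT.norm fun i => ?_
  have h1 := ((ContinuousLinearMap.nonneg_iff_isPositive S).mp hS).inner_nonneg_right (basis H i)
  have h2 := ((ContinuousLinearMap.nonneg_iff_isPositive _).mp
    (sub_nonneg.mpr hST)).inner_nonneg_right (basis H i)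
  refine CStarAlgebra.norm_le_norm_of_nonneg_of_le h1 ?_
  refine sub_nonneg.mp ?_
  rw [← inner_sub_right]
  exact h2

/-- Hölder's inequality `|tr (D T)| ≤ ‖D‖₁ ‖T‖` for self-adjoint trace class `D`. -/
theorem norm_trace_mul_le {D : H →L[ℂ] H} (hD : IsSelfAdjoint D) (h : IsTraceClass D)
    (T : H →L[ℂ] H) : ‖trace (D * T)‖ ≤ ‖T‖ * traceNorm D := by
  have hp := CFC.posPart_nonneg D
  have hn := CFC.negPart_nonneg D
  -- The trace norm splits as tr D⁺ + tr D⁻, reducing the claim to positive operators.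
  have habs : D⁺ + D⁻ = CFC.abs D := CFC.posPart_add_negPart D hD
  have hps : DiagSummable D⁺ := .of_le hp (by rw [← habs]; exact le_add_of_nonneg_right hn) h
  have hns : DiagSummable D⁻ := .of_le hn (by rw [← habs]; exact le_add_of_nonneg_left hp) h
  have hDT : D * T = D⁺ * T - D⁻ * T := by rw [← sub_mul, CFC.posPart_sub_negPart D hD]
  rw [hDT, trace_sub (diagSummable_mul hp hps T) (diagSummable_mul hn hns T), traceNorm, ← habs,
    trace_add hps hns, Complex.add_re, mul_add]
  exact (norm_sub_le _ _).trans (add_le_add (norm_trace_mul_le_of_nonneg hp hps T)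
    (norm_trace_mul_le_of_nonneg hn hns T))

open scoped ComplexOrder in
theorem traceNorm_nonneg (T : H →L[ℂ] H) : 0 ≤ traceNorm T := by
  have h : 0 ≤ trace (CFC.abs T) := tsum_nonneg fun i =>
    ((ContinuousLinearMap.nonneg_iff_isPositive _).mp (CFC.abs_nonneg T)).inner_nonneg_right _
  exact (Complex.le_def.mp h).1

end Trace

/-! ### Spectral projections and the convergence of Λ_A(ρ). -/

section SpectralProjection

variable {H : Type*} [NormedAddCommGroup H] [InnerProductSpace ℂ H] [CompleteSpace H]

theorem isStarProjection_specProj (A : H →L[ℂ] H) (a : ℝ) : IsStarProjection (specProj A a) :=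
  isStarProjection_starProjection

omit [CompleteSpace H] in
theorem apply_of_mem_ker {A : H →L[ℂ] H} {a : ℝ} {x : H}
    (hx : x ∈ (A - (a : ℂ) • (1 : H →L[ℂ] H)).ker) : A x = (a : ℂ) • x := by
  have h : (A - (a : ℂ) • (1 : H →L[ℂ] H)) x = 0 := hx
  simpa [sub_eq_zero] using h

theorem specProj_mul_specProj_of_ne {A : H →L[ℂ] H} (hA : IsSelfAdjoint A) {a b : ℝ}
    (hab : a ≠ b) : specProj A a * specProj A b = 0 := by
  refine Submodule.IsOrtho.starProjection_comp_starProjection ?_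
  refine Submodule.isOrtho_iff_inner_eq.mpr fun x hx y hy => ?_
  have h := ContinuousLinearMap.adjoint_inner_left A y x
  rw [← ContinuousLinearMap.star_eq_adjoint, hA.star_eq, apply_of_mem_ker hx,
    apply_of_mem_ker hy, inner_smul_left, inner_smul_right, Complex.conj_ofReal] at h
  have h' : ((a : ℂ) - b) * ⟪x, y⟫_ℂ = 0 := by rw [sub_mul, h, sub_self]
  refine (mul_eq_zero.mp h').resolve_left (sub_ne_zero.mpr ?_)
  exact_mod_cast hab

/-- Bessel's inequality for mutually orthogonal projections. -/
theorem sum_norm_sq_le_of_orthogonal {ι : Type*} {P : ι → H →L[ℂ] H}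
    (hP : ∀ i, IsStarProjection (P i)) (hort : Pairwise fun i j => P i * P j = 0)
    (F : Finset ι) (x : H) : ∑ i ∈ F, ‖P i x‖ ^ 2 ≤ ‖x‖ ^ 2 := by
  -- The finite sum is itself a projection, so 1 minus it is positive.
  have hp : IsStarProjection (∑ i ∈ F, P i) := by
    refine ⟨?_, ?_⟩
    · rw [IsIdempotentElem, Finset.sum_mul_sum]
      refine Finset.sum_congr rfl fun i hi => ?_
      rw [Finset.sum_eq_single_of_mem i hi fun j _ hj => hort hj.symm,
        (hP i).isIdempotentElem.eq]
    · exact isSelfAdjoint_sum F fun i _ => (hP i).isSelfAdjoint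
  have h := (ContinuousLinearMap.IsPositive.of_isStarProjection hp.one_sub).re_inner_nonneg_right x
  have hi : ∀ i, ⟪x, P i x⟫_ℂ = ((‖P i x‖ ^ 2 : ℝ) : ℂ) := fun i => by
    rw [← inner_mul_self_eq_norm_sq (hP i).isSelfAdjoint, (hP i).isIdempotentElem.eq]
  have hx : ⟪x, (1 - ∑ i ∈ F, P i) x⟫_ℂ = ((‖x‖ ^ 2 - ∑ i ∈ F, ‖P i x‖ ^ 2 : ℝ) : ℂ) := by
    rw [_root_.sub_apply, inner_sub_right, _root_.sum_apply, inner_sum,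
      Finset.sum_congr rfl fun i _ => hi i, one_apply_eq_self,
      inner_self_eq_norm_sq_to_K]
    push_cast
    rfl
  rw [hx] at h
  have h' : 0 ≤ ‖x‖ ^ 2 - ∑ i ∈ F, ‖P i x‖ ^ 2 := h
  linarith

/-- Taking adjoints turns R P i into P i R; Bessel at each R (e k), summed over k, then bounds all
finite sums by the Hilbert–Schmidt norm squared of R. -/
theorem summable_hsNormSq_mul {ι : Type*} {P : ι → H →L[ℂ] H}
    (hP : ∀ i, IsStarProjection (P i)) (hort : Pairwise fun i j => P i * P j = 0)
    {R : H →L[ℂ] H} (hsa : IsSelfAdjoint R) (hR : IsHilbertSchmidt R) :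
    Summable fun i => hsNormSq (R * P i) := by
  refine summable_of_sum_le (c := hsNormSq R) (fun i => tsum_nonneg fun _ => by positivity)
    fun F => ?_
  have hswap : ∀ i, hsNormSq (R * P i) = hsNormSq (P i * R) := fun i => by
    rw [← hsNormSq_star (hR.mul_right (P i)), star_mul, hsa.star_eq,
      (hP i).isSelfAdjoint.star_eq]
  rw [Finset.sum_congr rfl fun i _ => hswap i]
  unfold hsNormSq
  rw [← Summable.tsum_finsetSum fun i _ => hR.mul_left (P i)]
  exact Summable.tsum_le_tsum (fun k => sum_norm_sq_le_of_orthogonal hP hort F (R (basis H k)))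
    (summable_sum fun i _ => hR.mul_left (P i)) hR

theorem lueders_eq_star_mul_self (A : H →L[ℂ] H) (a : ℝ) {R : H →L[ℂ] H}
    (hsa : IsSelfAdjoint R) :
    lueders A a (R * R) = star (R * specProj A a) * (R * specProj A a) := by
  rw [lueders, star_mul, hsa.star_eq, (isStarProjection_specProj A a).isSelfAdjoint.star_eq]
  simp only [mul_assoc]

theorem lueders_nonneg (A : H →L[ℂ] H) (a : ℝ) {ρ : H →L[ℂ] H} (hρ : 0 ≤ ρ) :
    0 ≤ lueders A a ρ := by
  have h := star_left_conjugate_nonneg hρ (specProj A a)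
  rwa [(isStarProjection_specProj A a).isSelfAdjoint.star_eq] at h

theorem inner_lueders_apply (A : H →L[ℂ] H) (a : ℝ) {R : H →L[ℂ] H} (hsa : IsSelfAdjoint R)
    (x : H) : ⟪x, lueders A a (R * R) x⟫_ℂ = ((‖(R * specProj A a) x‖ ^ 2 : ℝ) : ℂ) := by
  rw [lueders_eq_star_mul_self A a hsa, mul_apply_eq_comp,
    ContinuousLinearMap.star_eq_adjoint, ContinuousLinearMap.adjoint_inner_right,
    inner_self_eq_norm_sq_to_K]
  push_cast
  rfl

theorem diagSummable_lueders (A : H →L[ℂ] H) (a : ℝ) {ρ : H →L[ℂ] H} (hρ : 0 ≤ ρ)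
    (h : DiagSummable ρ) : DiagSummable (lueders A a ρ) := by
  obtain ⟨R, hsa, hR, rfl⟩ := exists_isHilbertSchmidt_mul_self hρ h
  refine (Complex.summable_ofReal.mpr (hR.mul_right (specProj A a))).congr fun i => ?_
  exact (inner_lueders_apply A a hsa _).symm

variable {A ρ : H →L[ℂ] H}

theorem pairwise_specProj_mul (hA : IsSelfAdjoint A) :
    Pairwise fun a b : spectrum ℝ A => specProj A a * specProj A b = 0 :=
  fun _ _ hab => specProj_mul_specProj_of_ne hA fun h => hab (Subtype.ext h)

/-- The convergence is even absolute: ‖PR²P‖ = ‖RP‖², dominated by the squared Hilbert–Schmidt norm.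
-/
theorem summable_lueders (hA : IsSelfAdjoint A) (hρ : 0 ≤ ρ) (h : DiagSummable ρ) :
    Summable fun a : spectrum ℝ A => lueders A a ρ := by
  obtain ⟨R, hsa, hR, rfl⟩ := exists_isHilbertSchmidt_mul_self hρ h
  refine Summable.of_norm_bounded (summable_hsNormSq_mul
    (fun a : spectrum ℝ A => isStarProjection_specProj A a) (pairwise_specProj_mul hA) hsa hR)
    fun a => ?_
  rw [lueders_eq_star_mul_self A a hsa, CStarRing.norm_star_mul_self, ← pow_two]
  exact norm_sq_le_hsNormSq (hR.mul_right _)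

theorem nonselective_nonneg (A : H →L[ℂ] H) (hρ : 0 ≤ ρ) : 0 ≤ nonselective A ρ :=
  tsum_nonneg fun a => lueders_nonneg A a hρ

theorem hasSum_inner_lueders_apply (hA : IsSelfAdjoint A) (hρ : 0 ≤ ρ) (h : DiagSummable ρ)
    (x : H) :
    HasSum (fun a : spectrum ℝ A => ⟪x, lueders A a ρ x⟫_ℂ) ⟪x, nonselective A ρ x⟫_ℂ := by
  have h0 : HasSum (fun a : spectrum ℝ A => lueders A a ρ) (nonselective A ρ) :=
    (summable_lueders hA hρ h).hasSum
  have h1 : HasSum (fun a : spectrum ℝ A => lueders A a ρ x) (nonselective A ρ x) := by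
    simpa only [ContinuousLinearMap.apply_apply] using h0.mapL (ContinuousLinearMap.apply ℂ H x)
  exact (innerSL ℂ x).hasSum h1

theorem summable_norm_sq_mul_specProj (hA : IsSelfAdjoint A) {R : H →L[ℂ] H}
    (hsa : IsSelfAdjoint R) (hR : IsHilbertSchmidt R) :
    Summable fun p : spectrum ℝ A × basisIndex H =>
      ‖(R * specProj A p.1) (basis H p.2)‖ ^ 2 := by
  refine (summable_prod_of_nonneg fun _ => by positivity).mpr ⟨fun a => ?_, ?_⟩
  · exact hR.mul_right (specProj A a)
  exact summable_hsNormSq_mul (fun a : spectrum ℝ A => isStarProjection_specProj A a)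
    (pairwise_specProj_mul hA) hsa hR

theorem diagSummable_nonselective (hA : IsSelfAdjoint A) (hρ : 0 ≤ ρ) (h : DiagSummable ρ) :
    DiagSummable (nonselective A ρ) := by
  have hev := fun i => hasSum_inner_lueders_apply hA hρ h (basis H i)
  obtain ⟨R, hsa, hR, rfl⟩ := exists_isHilbertSchmidt_mul_self hρ h
  have hsum : Summable fun i => ∑' a : spectrum ℝ A, ‖(R * specProj A a) (basis H i)‖ ^ 2 :=
    (summable_norm_sq_mul_specProj hA hsa hR).prod_symm.prod
  refine Summable.congr (Complex.summable_ofReal.mpr hsum) fun i => ?_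
  rw [← (hev i).tsum_eq, Complex.ofReal_tsum]
  exact tsum_congr fun a => (inner_lueders_apply A a hsa _).symm

theorem specProj_mul_lueders_of_ne (hA : IsSelfAdjoint A) {a b : ℝ} (hab : a ≠ b) :
    specProj A a * lueders A b ρ = 0 := by
  rw [lueders, ← mul_assoc, ← mul_assoc, specProj_mul_specProj_of_ne hA hab, zero_mul, zero_mul]

theorem lueders_mul_specProj_of_ne (hA : IsSelfAdjoint A) {a b : ℝ} (hab : a ≠ b) :
    lueders A b ρ * specProj A a = 0 := by
  rw [lueders, mul_assoc, specProj_mul_specProj_of_ne hA hab.symm, mul_zero]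

theorem specProj_mul_nonselective (hA : IsSelfAdjoint A) (hρ : 0 ≤ ρ) (h : DiagSummable ρ)
    {a : ℝ} (ha : a ∈ spectrum ℝ A) : specProj A a * nonselective A ρ = lueders A a ρ := by
  rw [nonselective, ← (summable_lueders hA hρ h).tsum_mul_left,
    tsum_eq_single ⟨a, ha⟩ fun b hb =>
      specProj_mul_lueders_of_ne hA fun h => hb (Subtype.ext h.symm)]
  rw [lueders, ← mul_assoc, ← mul_assoc, (isStarProjection_specProj A a).isIdempotentElem.eq]

theorem nonselective_mul_specProj (hA : IsSelfAdjoint A) (hρ : 0 ≤ ρ) (h : DiagSummable ρ)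
    {a : ℝ} (ha : a ∈ spectrum ℝ A) : nonselective A ρ * specProj A a = lueders A a ρ := by
  rw [nonselective, ← (summable_lueders hA hρ h).tsum_mul_right,
    tsum_eq_single ⟨a, ha⟩ fun b hb =>
      lueders_mul_specProj_of_ne hA fun h => hb (Subtype.ext h.symm)]
  rw [lueders, mul_assoc, (isStarProjection_specProj A a).isIdempotentElem.eq]

end SpectralProjection

/-! ### The trace formula for the difference and the commutator bound. -/

section Invasiveness

variable {H : Type*} [NormedAddCommGroup H] [InnerProductSpace ℂ H] [CompleteSpace H]
  {A ρ : H →L[ℂ] H}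

theorem diagSummable_sub_mul (hA : IsSelfAdjoint A) (hρ : 0 ≤ ρ) (h : DiagSummable ρ)
    (T : H →L[ℂ] H) : DiagSummable ((nonselective A ρ - ρ) * T) := by
  rw [sub_mul]
  exact (diagSummable_mul (nonselective_nonneg A hρ) (diagSummable_nonselective hA hρ h) T).sub
    (diagSummable_mul hρ h T)

theorem trace_mul_alphaProd {S : H →L[ℂ] H} (h : ∀ T : H →L[ℂ] H, DiagSummable (S * T)) (α : ℝ)
    (X Y : H →L[ℂ] H) :
    trace (S * alphaProd α X Y) = α * trace (S * (X * Y)) + (1 - α) * trace (S * (Y * X)) := by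
  rw [alphaProd, mul_add, mul_smul_comm, mul_smul_comm, trace_add ((h _).smul _) ((h _).smul _),
    trace_smul, trace_smul]

/-- The operational joint probability is the quasi-joint distribution in the state `Λ_A(ρ)`. -/
theorem opProb_eq_trace_nonselective_mul (hA : IsSelfAdjoint A) (hρ : 0 ≤ ρ)
    (h : DiagSummable ρ) (α : ℝ) (B : H →L[ℂ] H) {a : ℝ} (ha : a ∈ spectrum ℝ A) (b : ℝ) :
    opProb A B ρ a b = trace (nonselective A ρ * alphaProd α (specProj A a) (specProj B b)) := by
  have hΛ := nonselective_nonneg A hρ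
  have hΛ' := diagSummable_nonselective hA hρ h
  -- Both orderings have the same trace against Λ_A(ρ), so the weights α and 1 - α add up to 1.
  rw [trace_mul_alphaProd (diagSummable_mul hΛ hΛ'), ← mul_assoc,
    nonselective_mul_specProj hA hρ h ha, trace_mul_comm hΛ hΛ' (specProj B b * specProj A a),
    mul_assoc (specProj B b), specProj_mul_nonselective hA hρ h ha,
    ← trace_mul_comm (lueders_nonneg A a hρ) (diagSummable_lueders A a hρ h), opProb]
  ring

theorem opProb_sub_quasiProb (hA : IsSelfAdjoint A) (hρ : 0 ≤ ρ) (h : DiagSummable ρ) (α : ℝ)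
    (B : H →L[ℂ] H) {a : ℝ} (ha : a ∈ spectrum ℝ A) (b : ℝ) :
    opProb A B ρ a b - quasiProb α A B ρ a b =
      trace ((nonselective A ρ - ρ) * alphaProd α (specProj A a) (specProj B b)) := by
  rw [sub_mul, trace_sub (diagSummable_mul (nonselective_nonneg A hρ)
      (diagSummable_nonselective hA hρ h) _) (diagSummable_mul hρ h _),
    ← opProb_eq_trace_nonselective_mul hA hρ h α B ha b, quasiProb]

/-- Λ_A(ρ) and ρ have the same diagonal block PρP, and cyclicity makes only this block visible. -/
theorem trace_sub_mul_compression (hA : IsSelfAdjoint A) (hρ : 0 ≤ ρ) (h : DiagSummable ρ)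
    {a : ℝ} (ha : a ∈ spectrum ℝ A) (Q : H →L[ℂ] H) :
    trace ((nonselective A ρ - ρ) * (specProj A a * Q * specProj A a)) = 0 := by
  have hΛ := nonselective_nonneg A hρ
  have hΛ' := diagSummable_nonselective hA hρ h
  have hP : lueders A a ρ * (specProj A a * Q) = specProj A a * ρ * (specProj A a * Q) := by
    rw [lueders, ← mul_assoc, mul_assoc _ (specProj A a) (specProj A a),
      (isStarProjection_specProj A a).isIdempotentElem.eq, mul_assoc]
  rw [sub_mul, trace_sub (diagSummable_mul hΛ hΛ' _) (diagSummable_mul hρ h _),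
    trace_mul_mul_cycle hΛ hΛ', trace_mul_mul_cycle hρ h, specProj_mul_nonselective hA hρ h ha,
    hP, sub_self]

/-- P[P,Q] = PQ - PQP, and the compression PQP contributes nothing. -/
theorem trace_sub_mul_specProj_mul (hA : IsSelfAdjoint A) (hρ : 0 ≤ ρ) (h : DiagSummable ρ)
    {a : ℝ} (ha : a ∈ spectrum ℝ A) (Q : H →L[ℂ] H) :
    trace ((nonselective A ρ - ρ) * (specProj A a * Q)) =
      trace ((nonselective A ρ - ρ) * (specProj A a * (specProj A a * Q - Q * specProj A a))) := by
  rw [mul_sub (specProj A a), ← mul_assoc (specProj A a), ← mul_assoc (specProj A a) Q,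
    (isStarProjection_specProj A a).isIdempotentElem.eq, mul_sub _ (specProj A a * Q),
    trace_sub (diagSummable_sub_mul hA hρ h _) (diagSummable_sub_mul hA hρ h _),
    trace_sub_mul_compression hA hρ h ha, sub_zero]

theorem trace_sub_mul_mul_specProj (hA : IsSelfAdjoint A) (hρ : 0 ≤ ρ) (h : DiagSummable ρ)
    {a : ℝ} (ha : a ∈ spectrum ℝ A) (Q : H →L[ℂ] H) :
    trace ((nonselective A ρ - ρ) * (Q * specProj A a)) =
      -trace ((nonselective A ρ - ρ) *
        ((specProj A a * Q - Q * specProj A a) * specProj A a)) := by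
  rw [sub_mul _ _ (specProj A a), mul_assoc Q,
    (isStarProjection_specProj A a).isIdempotentElem.eq, mul_sub _ (specProj A a * Q * _),
    trace_sub (diagSummable_sub_mul hA hρ h _) (diagSummable_sub_mul hA hρ h _),
    trace_sub_mul_compression hA hρ h ha, zero_sub, neg_neg]

theorem isTraceClass_nonselective_sub (hA : IsSelfAdjoint A) (hρ : 0 ≤ ρ) (h : DiagSummable ρ) :
    IsTraceClass (nonselective A ρ - ρ) :=
  isTraceClass_sub (nonselective_nonneg A hρ) (diagSummable_nonselective hA hρ h) hρ h

theorem norm_trace_sub_mul_le (hA : IsSelfAdjoint A) (hρ : 0 ≤ ρ) (h : DiagSummable ρ)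
    (T : H →L[ℂ] H) :
    ‖trace ((nonselective A ρ - ρ) * T)‖ ≤ ‖T‖ * invasiveness A ρ :=
  norm_trace_mul_le ((nonselective_nonneg A hρ).isSelfAdjoint.sub hρ.isSelfAdjoint)
    (isTraceClass_nonselective_sub hA hρ h) T

theorem norm_opProb_sub_quasiProb_le_commutator (hA : IsSelfAdjoint A) (hρ : 0 ≤ ρ)
    (h : DiagSummable ρ) {α : ℝ} (hα : α ∈ Set.Icc (0 : ℝ) 1) (B : H →L[ℂ] H) {a : ℝ}
    (ha : a ∈ spectrum ℝ A) (b : ℝ) :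
    ‖opProb A B ρ a b - quasiProb α A B ρ a b‖ ≤
      ‖specProj A a * specProj B b - specProj B b * specProj A a‖ * invasiveness A ρ := by
  set C := specProj A a * specProj B b - specProj B b * specProj A a with hC
  have hP : ‖specProj A a‖ ≤ 1 := Submodule.starProjection_norm_le _
  have hI : 0 ≤ invasiveness A ρ := traceNorm_nonneg (nonselective A ρ - ρ)
  have h1 : ‖trace ((nonselective A ρ - ρ) * (specProj A a * specProj B b))‖ ≤
      ‖C‖ * invasiveness A ρ := by
    rw [trace_sub_mul_specProj_mul hA hρ h ha]
    refine (norm_trace_sub_mul_le hA hρ h _).trans (mul_le_mul_of_nonneg_right ?_ hI)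
    exact (norm_mul_le _ _).trans (mul_le_of_le_one_left (norm_nonneg _) hP)
  have h2 : ‖trace ((nonselective A ρ - ρ) * (specProj B b * specProj A a))‖ ≤
      ‖C‖ * invasiveness A ρ := by
    rw [trace_sub_mul_mul_specProj hA hρ h ha, norm_neg]
    refine (norm_trace_sub_mul_le hA hρ h _).trans (mul_le_mul_of_nonneg_right ?_ hI)
    exact (norm_mul_le _ _).trans (mul_le_of_le_one_right (norm_nonneg _) hP)
  have hα' : (0 : ℝ) ≤ 1 - α := sub_nonneg.mpr hα.2
  rw [opProb_sub_quasiProb hA hρ h α B ha b, trace_mul_alphaProd (diagSummable_sub_mul hA hρ h)]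
  refine (norm_add_le _ _).trans ?_
  have hn : ‖(1 - (α : ℂ))‖ = 1 - α := by
    rw [← Complex.ofReal_one, ← Complex.ofReal_sub, Complex.norm_of_nonneg hα']
  rw [norm_mul, norm_mul, Complex.norm_of_nonneg hα.1, hn]
  calc _ ≤ α * (‖C‖ * invasiveness A ρ) + (1 - α) * (‖C‖ * invasiveness A ρ) :=
        add_le_add (mul_le_mul_of_nonneg_left h1 hα.1) (mul_le_mul_of_nonneg_left h2 hα')
    _ = ‖C‖ * invasiveness A ρ := by ring

end Invasiveness

end QuantumInvasiveness

open QuantumInvasiveness in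
theorem mainTheorem3 {H : Type*} [NormedAddCommGroup H] [InnerProductSpace ℂ H] [CompleteSpace H]
    (A B ρ : H →L[ℂ] H) (hA : IsObservable A) (hB : IsObservable B) (hρ : IsState ρ)
    (α : ℝ) (hα : α ∈ Set.Icc (0 : ℝ) 1) :
    Summable (fun a : spectrum ℝ A => lueders A a ρ) ∧
    IsTraceClass (nonselective A ρ - ρ) ∧
    ∀ a ∈ spectrum ℝ A, ∀ b ∈ spectrum ℝ B,
      ‖opProb A B ρ a b - quasiProb α A B ρ a b‖ ≤
        min ‖specProj A a * specProj B b - specProj B b * specProj A a‖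
            ‖alphaProd α (specProj A a) (specProj B b)‖ * invasiveness A ρ := by
  have hAs := hA.isSelfAdjoint
  have hρ0 : 0 ≤ ρ := (ContinuousLinearMap.nonneg_iff_isPositive ρ).mpr hρ.isPositive
  -- |ρ| = ρ, so trace class is summability of the diagonal of ρ itself.
  have hd : DiagSummable ρ := by
    have h := hρ.isTraceClass
    rwa [IsTraceClass, CFC.abs_of_nonneg ρ hρ0] at h
  refine ⟨summable_lueders hAs hρ0 hd, isTraceClass_nonselective_sub hAs hρ0 hd,
    fun a ha b _ => ?_⟩
  have hI : 0 ≤ invasiveness A ρ := traceNorm_nonneg _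
  rw [min_mul_of_nonneg _ _ hI]
  refine le_min (norm_opProb_sub_quasiProb_le_commutator hAs hρ0 hd hα B ha b) ?_
  rw [opProb_sub_quasiProb hAs hρ0 hd α B ha b]
  exact norm_trace_sub_mul_le hAs hρ0 hd _
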